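/- Let $b\ge 2$ be an integer. For $n\ge 1$ let $\mathrm{rep}_b(n)$ be the base-$b$ expansion of $n$, written with the most significant digit first and starting with a non-zero digit, and let $\mathrm{rep}_b(0)=\varepsilon$ be the empty word. Let $L_b=\{1,\ldots,b-1\}\{0,\ldots,b-1\}^*\cup\{\varepsilon\}$. For finite words $u,v$ let $\binom{u}{v}$ be the number of times $v$ occurs as a subsequence (scattered subword) of $u$. Put $$S_b(n)=\#\left\{v\in L_b : \binom{\mathrm{rep}_b(n)}{v}>0\right\}\quad (n\ge 0),\qquad A_b(0)=0,\qquad A_b(n)=\sum_{j=0}^{n-1}S_b(j)\quad (n\ge 1).$$ Then there exists a continuous function $\mathcal{H}_b:\mathbb{R}\to\mathbb{R}$, periodic of period $1$, such that, for all large enough integers $n$, $$A_b(n)=(2b-1)^{\log_b n}\,\mathcal{H}_b(\log_b n).$$ -/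

import Mathlib

namespace Subword

/-- The binomial coefficient of two finite words: the number of times `v` occurs as a
(scattered) subsequence of `u`. The list `u.sublists` lists the subsequences of `u`, one for
each choice of positions, so that repeated occurrences are counted. -/
def wordBinom {α : Type*} [DecidableEq α] (u v : List α) : ℕ :=
  u.sublists.count v

/-- The base-`b` expansion of `n`, most significant digit first; the empty word for `n = 0`. -/
def rep (b n : ℕ) : List ℕ :=
  (Nat.digits b n).reverse

/-- The language of base-`b` expansions: the words over `{0, …, b - 1}` that are empty or start
with a non-zero digit. -/
def lang (b : ℕ) : Set (List ℕ) :=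
  {w | (∀ d ∈ w, d < b) ∧ (w = [] ∨ ∃ a t, w = a :: t ∧ a ≠ 0)}

/-- The number of words of the language that occur as subwords in the base-`b` expansion
of `n`. -/
noncomputable def S (b n : ℕ) : ℕ :=
  {v : List ℕ | v ∈ lang b ∧ 0 < wordBinom (rep b n) v}.ncard

/-- The summatory function `A b n = S b 0 + ⋯ + S b (n - 1)`. -/
noncomputable def A (b n : ℕ) : ℕ :=
  ∑ j ∈ Finset.range n, S b j

end Subword

namespace Subword

open Filter Topology

/-! Reading digits least significant first, `S b n` counts the distinct subwords of `Nat.digits b n`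
that do not end in zero. Summing this count over all digits that can be prepended multiplies it by
`2 * b - 1` (`sum_card_goodSublists_cons`), whence the exact scaling law `A_mul`. By this law `A b`
extends to a monotone `interp b` on the reals with the same scaling, and H(t) = interp(b^t) /
(2b-1)^t is periodic. Continuity holds because `S b n` is at most 2^k for n < b^k, while 2 < 2b-1.
-/

/-! ### Counting distinct subwords -/

/-- The distinct subsequences of `w` whose last letter, if any, is non-zero. -/
def goodSublists (w : List ℕ) : Finset (List ℕ) :=
  w.sublists.toFinset.filter fun v => v.getLast? ≠ some 0

lemma mem_goodSublists {w v : List ℕ} :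
    v ∈ goodSublists w ↔ v.Sublist w ∧ v.getLast? ≠ some 0 := by
  simp [goodSublists]

lemma nil_mem_goodSublists (w : List ℕ) : [] ∈ goodSublists w := by
  simp [mem_goodSublists]

lemma card_goodSublists_le (w : List ℕ) : (goodSublists w).card ≤ 2 ^ w.length := by
  calc (goodSublists w).card ≤ w.sublists.toFinset.card := Finset.card_filter_le _ _
    _ ≤ w.sublists.length := List.toFinset_card_le _
    _ = 2 ^ w.length := List.length_sublists w

lemma goodSublists_cons (c : ℕ) (w : List ℕ) :
    goodSublists (c :: w) = goodSublists w ∪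
      ((goodSublists w).filter fun v => (c :: v).getLast? ≠ some 0).image (List.cons c) := by
  ext v
  simp only [Finset.mem_union, Finset.mem_image, Finset.mem_filter, mem_goodSublists,
    List.sublist_cons_iff]
  constructor
  · rintro ⟨h | ⟨r, rfl, hr⟩, hv⟩
    · exact Or.inl ⟨h, hv⟩
    · refine Or.inr ⟨r, ⟨⟨hr, ?_⟩, hv⟩, rfl⟩
      cases r with
      | nil => simp
      | cons d r => simpa [List.getLast?_cons_cons] using hv
  · rintro (⟨h, hv⟩ | ⟨r, ⟨⟨hr, -⟩, hv⟩, rfl⟩)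
    · exact ⟨Or.inl h, hv⟩
    · exact ⟨Or.inr ⟨r, rfl, hr⟩, hv⟩

lemma card_filter_getLast_cons (c : ℕ) (w : List ℕ) :
    ((goodSublists w).filter fun v => (c :: v).getLast? ≠ some 0).card + (if c = 0 then 1 else 0)
      = (goodSublists w).card := by
  split_ifs with hc
  · subst hc
    have : ((goodSublists w).filter fun v => (0 :: v).getLast? ≠ some 0)
        = (goodSublists w).erase [] := by
      ext v
      simp only [Finset.mem_filter, Finset.mem_erase, and_comm]
      refine and_congr_left fun hv => ?_
      cases v with
      | nil => simp
      | cons d r => simpa [List.getLast?_cons_cons] using (mem_goodSublists.1 hv).2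
    rw [this, Finset.card_erase_add_one (nil_mem_goodSublists w)]
  · rw [add_zero, Finset.filter_true_of_mem]
    intro v hv
    cases v with
    | nil => simpa using hc
    | cons d r => simpa [List.getLast?_cons_cons] using (mem_goodSublists.1 hv).2

/-- Inclusion-exclusion: a word `c :: r` with `r` good is counted twice exactly when it is already
good in `w`. For `c = 0` the word `[0]` is lost. -/
lemma card_goodSublists_cons (c : ℕ) (w : List ℕ) :
    (goodSublists (c :: w)).card + ((goodSublists w).filter fun v => v.head? = some c).card
      + (if c = 0 then 1 else 0) = 2 * (goodSublists w).card := by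
  have hinter : goodSublists w ∩
      ((goodSublists w).filter fun v => (c :: v).getLast? ≠ some 0).image (List.cons c)
      = (goodSublists w).filter fun v => v.head? = some c := by
    ext v
    simp only [Finset.mem_inter, Finset.mem_image, Finset.mem_filter]
    refine and_congr_right fun hv => ⟨?_, fun h => ?_⟩
    · rintro ⟨r, -, rfl⟩
      simp
    · cases v with
      | nil => simp at h
      | cons d r =>
        obtain rfl : d = c := by simpa using h
        obtain ⟨h1, h2⟩ := mem_goodSublists.1 hv
        refine ⟨r, ⟨mem_goodSublists.2 ⟨(List.sublist_cons_self d r).trans h1, ?_⟩, h2⟩, rfl⟩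
        cases r with
        | nil => simp
        | cons e r => simpa [List.getLast?_cons_cons] using h2
  have hcard := Finset.card_union_add_card_inter (goodSublists w)
    (((goodSublists w).filter fun v => (c :: v).getLast? ≠ some 0).image (List.cons c))
  rw [hinter, ← goodSublists_cons, Finset.card_image_of_injective _ List.cons_injective] at hcard
  have := card_filter_getLast_cons c w
  omega

lemma sum_card_filter_head (b : ℕ) (w : List ℕ) (hw : ∀ d ∈ w, d < b) :
    ∑ c ∈ Finset.range b, ((goodSublists w).filter fun v => v.head? = some c).card + 1
      = (goodSublists w).card := by
  rw [← Finset.card_erase_add_one (nil_mem_goodSublists w)]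
  congr 1
  rw [Finset.card_eq_sum_card_fiberwise (f := fun v : List ℕ => v.headD 0)
    (t := Finset.range b)]
  · refine Finset.sum_congr rfl fun c _ => congrArg Finset.card ?_
    ext v
    cases v <;> simp
  · intro v hv
    simp only [Finset.coe_erase, Set.mem_sdiff, Finset.mem_coe, Set.mem_singleton_iff,
      mem_goodSublists] at hv
    cases v with
    | nil => simp at hv
    | cons d r => simpa using hw d (hv.1.1.subset (by simp))

/-- With N good words for `w`, the heads partition the N - 1 nonempty ones, and the loss at `c = 0`
supplies the missing 1: 2bN - (N - 1) - 1. -/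
lemma sum_card_goodSublists_cons {b : ℕ} (hb : 0 < b) (w : List ℕ) (hw : ∀ d ∈ w, d < b) :
    ∑ c ∈ Finset.range b, (goodSublists (c :: w)).card = (2 * b - 1) * (goodSublists w).card := by
  have h1 := Finset.sum_congr (rfl : Finset.range b = Finset.range b)
    fun c _ => card_goodSublists_cons c w
  rw [Finset.sum_add_distrib, Finset.sum_add_distrib, Finset.sum_const, Finset.card_range,
    Finset.sum_ite_eq' (Finset.range b) 0, if_pos (Finset.mem_range.2 hb), smul_eq_mul] at h1
  have h2 := sum_card_filter_head b w hw
  rw [Nat.sub_mul, one_mul]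
  have : b * (2 * (goodSublists w).card) = 2 * b * (goodSublists w).card := by ring
  omega

lemma S_eq_card {b : ℕ} (hb : 2 ≤ b) (n : ℕ) : S b n = (goodSublists (Nat.digits b n)).card := by
  rw [S, ← Finset.card_image_of_injective _ List.reverse_injective, ← Set.ncard_coe_finset]
  congr 1
  ext v
  simp only [Set.mem_ofPred_eq, Finset.coe_image, Set.mem_image, Finset.mem_coe, wordBinom,
    List.count_pos_iff, List.mem_sublists, lang, rep, mem_goodSublists]
  constructor
  · rintro ⟨⟨-, h⟩, hv⟩
    refine ⟨v.reverse, ⟨by simpa using hv.reverse, ?_⟩, List.reverse_reverse v⟩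
    rcases h with rfl | ⟨a, t, rfl, ha⟩ <;> simp [*]
  · rintro ⟨u, ⟨hu, hl⟩, rfl⟩
    refine ⟨⟨fun d hd => Nat.digits_lt_base hb (hu.subset (List.mem_reverse.1 hd)), ?_⟩,
      hu.reverse⟩
    rw [← List.head?_reverse] at hl
    cases h : u.reverse with
    | nil => exact Or.inl rfl
    | cons a t => exact Or.inr ⟨a, t, rfl, by simpa [h] using hl⟩

lemma S_mul_add {b : ℕ} (hb : 2 ≤ b) (m : ℕ) {c : ℕ} (hc : c < b) :
    S b (b * m + c) = (goodSublists (c :: Nat.digits b m)).card := by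
  rw [S_eq_card hb]
  by_cases h : c = 0 ∧ m = 0
  -- Here the digit list is `[]`, not `[0]`, but both have only the empty good word.
  · obtain ⟨rfl, rfl⟩ := h
    simp only [mul_zero, add_zero, Nat.digits_zero]
    decide
  · rw [add_comm, Nat.digits_add b hb c m hc (by tauto)]

lemma S_le_two_pow {b : ℕ} (hb : 2 ≤ b) {n k : ℕ} (h : n < b ^ k) : S b n ≤ 2 ^ k := by
  rw [S_eq_card hb]
  exact (card_goodSublists_le _).trans
    (Nat.pow_le_pow_right two_pos ((Nat.digits_length_le_iff hb n).2 h))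

/-! ### Scaling of the summatory function -/

lemma A_succ (b n : ℕ) : A b (n + 1) = A b n + S b n := Finset.sum_range_succ _ _

lemma A_mono (b : ℕ) : Monotone (A b) :=
  monotone_nat_of_le_succ fun n => by rw [A_succ]; exact Nat.le_add_right _ _

lemma A_mul {b : ℕ} (hb : 2 ≤ b) (n : ℕ) : A b (b * n) = (2 * b - 1) * A b n := by
  induction n with
  | zero => simp [A]
  | succ n ih =>
    rw [A_succ, mul_add (2 * b - 1), ← ih, S_eq_card hb, ← sum_card_goodSublists_cons (by omega) _
      fun d hd => Nat.digits_lt_base hb hd, mul_add, mul_one, A, Finset.sum_range_add]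
    exact congrArg _ (Finset.sum_congr rfl fun c hc => S_mul_add hb n (Finset.mem_range.1 hc))

lemma A_mul_cast {b : ℕ} (hb : 2 ≤ b) (n : ℕ) :
    (A b (b * n) : ℝ) = (2 * b - 1) * A b n := by
  rw [A_mul hb, Nat.cast_mul, Nat.cast_sub (by omega)]
  push_cast
  rfl

lemma A_pow_mul {b : ℕ} (hb : 2 ≤ b) (k n : ℕ) :
    (A b (b ^ k * n) : ℝ) = (2 * b - 1) ^ k * A b n := by
  induction k with
  | zero => simp
  | succ k ih => rw [pow_succ', mul_assoc, A_mul_cast hb, ih, pow_succ', mul_assoc]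

/-! ### Interpolation to the reals -/

/-- The `k`-th approximation to the interpolation of `A b`. -/
noncomputable def approx (b k : ℕ) (x : ℝ) : ℝ :=
  A b ⌊(b : ℝ) ^ k * x⌋₊ / (2 * b - 1) ^ k

/-- The monotone function that extends `A b` and is multiplied by `2 * b - 1` when its argument
is multiplied by `b`. -/
noncomputable def interp (b : ℕ) (x : ℝ) : ℝ := ⨆ k, approx b k x

lemma two_mul_sub_one_pos {b : ℕ} (hb : 2 ≤ b) : (0 : ℝ) < 2 * b - 1 := by
  have : (2 : ℝ) ≤ b := by exact_mod_cast hb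
  linarith

lemma approx_mono_right {b : ℕ} (hb : 2 ≤ b) (k : ℕ) : Monotone (approx b k) := by
  intro x y h
  have := two_mul_sub_one_pos hb
  unfold approx
  gcongr
  exact A_mono b (by gcongr)

lemma approx_mono_left {b : ℕ} (hb : 2 ≤ b) (x : ℝ) : Monotone fun k => approx b k x := by
  refine monotone_nat_of_le_succ fun k => ?_
  have h := two_mul_sub_one_pos hb
  simp only [approx]
  rw [div_le_div_iff₀ (by positivity) (by positivity), pow_succ', mul_left_comm, ← mul_assoc,
    ← A_mul_cast hb]
  gcongr
  apply A_mono
  rcases le_total 0 x with hx | hx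
  · refine Nat.le_floor ?_
    rw [pow_succ', mul_assoc]
    push_cast
    gcongr
    exact Nat.floor_le (by positivity)
  · rw [Nat.floor_of_nonpos (mul_nonpos_of_nonneg_of_nonpos (by positivity) hx)]
    simp

lemma approx_bddAbove {b : ℕ} (hb : 2 ≤ b) (x : ℝ) :
    BddAbove (Set.range fun k => approx b k x) := by
  refine ⟨A b (⌊x⌋₊ + 1), ?_⟩
  rintro _ ⟨k, rfl⟩
  have h := two_mul_sub_one_pos hb
  simp only [approx]
  rw [div_le_iff₀' (by positivity), ← A_pow_mul hb]
  norm_cast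
  refine A_mono b (Nat.floor_le_of_le ?_)
  push_cast
  gcongr
  exact (Nat.lt_floor_add_one x).le

lemma tendsto_approx {b : ℕ} (hb : 2 ≤ b) (x : ℝ) :
    Tendsto (fun k => approx b k x) atTop (𝓝 (interp b x)) :=
  tendsto_atTop_ciSup (approx_mono_left hb x) (approx_bddAbove hb x)

lemma interp_mono {b : ℕ} (hb : 2 ≤ b) : Monotone (interp b) := fun _ y h =>
  ciSup_mono (approx_bddAbove hb y) fun k => approx_mono_right hb k h

lemma interp_mul {b : ℕ} (hb : 2 ≤ b) (x : ℝ) :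
    interp b (b * x) = (2 * b - 1) * interp b x := by
  refine tendsto_nhds_unique (tendsto_approx hb _) ?_
  refine (((tendsto_approx hb x).comp (tendsto_add_atTop_nat 1)).const_mul _).congr fun k => ?_
  have := two_mul_sub_one_pos hb
  simp only [approx, Function.comp_apply, pow_succ, ← mul_assoc]
  field_simp

lemma interp_natCast {b : ℕ} (hb : 2 ≤ b) (n : ℕ) : interp b n = A b n := by
  refine tendsto_nhds_unique (tendsto_approx hb _) (tendsto_const_nhds.congr fun k => ?_)
  have := two_mul_sub_one_pos hb
  rw [approx, show (b : ℝ) ^ k * n = ((b ^ k * n : ℕ) : ℝ) by push_cast; rfl, Nat.floor_natCast,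
    A_pow_mul hb]
  field_simp

lemma interp_pow_mul {b : ℕ} (hb : 2 ≤ b) (k : ℕ) (x : ℝ) :
    interp b (b ^ k * x) = (2 * b - 1) ^ k * interp b x := by
  induction k with
  | zero => simp
  | succ k ih => rw [pow_succ', mul_assoc, interp_mul hb, ih, pow_succ', mul_assoc]

lemma interp_div_pow {b : ℕ} (hb : 2 ≤ b) (k n : ℕ) :
    interp b (n / b ^ k) = A b n / (2 * b - 1) ^ k := by
  have h := two_mul_sub_one_pos hb
  have hb0 : (b : ℝ) ≠ 0 := by positivity
  rw [eq_div_iff (by positivity), mul_comm, ← interp_pow_mul hb, mul_div_cancel₀ _ (by positivity),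
    interp_natCast hb]

/-- By monotonicity it suffices to trap `x` between base-`b` fractions with close values. -/
lemma continuousAt_interp {b : ℕ} (hb : 2 ≤ b) {x : ℝ} (hx : 0 < x) :
    ContinuousAt (interp b) x := by
  have hβ := two_mul_sub_one_pos hb
  have hb2 : (2 : ℝ) ≤ b := by exact_mod_cast hb
  have hb1 : (1 : ℝ) < b := by linarith
  obtain ⟨K, hK⟩ := pow_unbounded_of_one_lt x hb1
  rw [Metric.continuousAt_iff']
  intro ε hε
  -- Bound for the increment across two cells of width b^(-k): two values of `S b`, each at most
  -- 2^(K+k), over (2b-1)^k.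
  have hlim : Tendsto (fun k : ℕ => (2 * 2 ^ K : ℝ) * (2 / (2 * b - 1)) ^ k) atTop (𝓝 0) := by
    simpa using (tendsto_pow_atTop_nhds_zero_of_lt_one (by positivity)
      ((div_lt_one hβ).2 (by linarith : (2 : ℝ) < 2 * b - 1))).const_mul (2 * 2 ^ K : ℝ)
  obtain ⟨k, hk, hkx⟩ := ((hlim.eventually_lt_const hε).and
    ((tendsto_pow_atTop_atTop_of_one_lt hb1).eventually_ge_atTop x⁻¹)).exists
  have hq : (0 : ℝ) < b ^ k := by positivity
  have hqx : 1 ≤ (b : ℝ) ^ k * x := by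
    rwa [inv_eq_one_div, div_le_iff₀ hx] at hkx
  -- Starting one cell below the floor keeps `x` strictly inside even when b^k x is an integer.
  obtain ⟨m, hm⟩ : ∃ m, ⌊(b : ℝ) ^ k * x⌋₊ = m + 1 :=
    Nat.exists_eq_succ_of_ne_zero (Nat.floor_pos.2 hqx).ne'
  have h1 : ((m : ℝ) + 1) ≤ b ^ k * x := by
    have := Nat.floor_le (zero_le_one.trans hqx)
    rw [hm] at this
    exact_mod_cast this
  have h2 : b ^ k * x < (m + 2 : ℝ) := by
    have := Nat.lt_floor_add_one ((b : ℝ) ^ k * x)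
    rw [hm] at this
    push_cast at this
    linarith
  have hmK : m + 1 < b ^ (K + k) := by
    have : ((m : ℝ) + 1) < b ^ (K + k) := by
      rw [pow_add, mul_comm]
      exact h1.trans_lt (by gcongr)
    exact_mod_cast this
  have hosc : interp b ((m + 2 : ℕ) / b ^ k) - interp b (m / b ^ k) < ε := by
    refine lt_of_le_of_lt ?_ hk
    rw [interp_div_pow hb, interp_div_pow hb, ← sub_div, A_succ, A_succ, div_pow, ← mul_div_assoc]
    have e1 : (S b m : ℝ) ≤ 2 ^ (K + k) := by
      exact_mod_cast S_le_two_pow hb (by omega : m < b ^ (K + k))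
    have e2 : (S b (m + 1) : ℝ) ≤ 2 ^ (K + k) := by exact_mod_cast S_le_two_pow hb hmK
    rw [pow_add] at e1 e2
    gcongr
    push_cast
    linarith
  have hlt : (m : ℝ) / b ^ k < x := by rw [div_lt_iff₀' hq]; linarith
  have hgt : x < ((m + 2 : ℕ) : ℝ) / b ^ k := by rw [lt_div_iff₀' hq]; push_cast; exact h2
  filter_upwards [Ioo_mem_nhds hlt hgt] with y hy
  have hmono := interp_mono hb
  have a1 := hmono hy.1.le
  have a2 := hmono hy.2.le
  have a3 := hmono hlt.le
  have a4 := hmono hgt.le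
  rw [Real.dist_eq, abs_sub_lt_iff]
  constructor <;> linarith

end Subword

theorem theorem9 (b : ℕ) (hb : 2 ≤ b) :
    ∃ H : ℝ → ℝ, Continuous H ∧ Function.Periodic H 1 ∧
      ∀ᶠ n : ℕ in Filter.atTop,
        (Subword.A b n : ℝ) =
          (2 * (b : ℝ) - 1) ^ Real.logb (b : ℝ) (n : ℝ) * H (Real.logb (b : ℝ) (n : ℝ)) := by
  have hβ := Subword.two_mul_sub_one_pos hb
  have hb1 : (1 : ℝ) < b := by exact_mod_cast hb
  have hb0 : (0 : ℝ) < b := by linarith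
  refine ⟨fun t => Subword.interp b ((b : ℝ) ^ t) / (2 * b - 1) ^ t, ?_, fun t => ?_, ?_⟩
  · refine Continuous.div ?_ (Real.continuous_const_rpow hβ.ne') fun t =>
      (Real.rpow_pos_of_pos hβ t).ne'
    exact continuous_iff_continuousAt.2 fun t =>
      (Subword.continuousAt_interp hb (Real.rpow_pos_of_pos hb0 t)).comp
        (Real.continuous_const_rpow hb0.ne').continuousAt
  · simp only [Real.rpow_add hb0, Real.rpow_add hβ, Real.rpow_one]
    rw [mul_comm _ (b : ℝ), Subword.interp_mul hb, mul_comm _ (2 * (b : ℝ) - 1),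
      mul_div_mul_left _ _ hβ.ne']
  · filter_upwards [Filter.eventually_gt_atTop 0] with n hn
    rw [mul_div_cancel₀ _ (Real.rpow_pos_of_pos hβ _).ne',
      Real.rpow_logb hb0 hb1.ne' (by exact_mod_cast hn), Subword.interp_natCast hb]
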